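/- For a nonempty finite set $A\subset\mathbb R$ put $\delta_A=\frac1{\#A}\sum_{a\in A}\delta_a$, where $\delta_a$ is the Dirac measure at $a$. A triple $(N,B,L)$, with $N\ge 2$ an integer and $B,L\subset\mathbb Z$ nonempty finite sets with $\#L=\#B=M\le N$, is a Hadamard triple if the matrix $H=\frac1{\sqrt M}\left[e^{-2\pi i bl/N}\right]_{b\in B,\,l\in L}$ is unitary, i.e. $H^*H=I$. A Borel probability measure $\mu$ on $\mathbb R$ is spectral if there is a countable set $\Lambda\subset\mathbb R$, called a spectrum of $\mu$, such that the functions $x\mapsto e^{2\pi i\lambda x}$, $\lambda\in\Lambda$, form an orthonormal basis of $L^2(\mu)$. Theorem. Let $(N_n,B_n,L_n)_{n\ge1}$ be a sequence of Hadamard triples with $B_n\subset\{0,1,\dots,N_n-1\}$ for all $n\ge 1$, and suppose that $\liminf_{n\to\infty}\#B_n<\infty$. Then the Cantor–Moran measure $$\mu(N_n,B_n)=\delta_{\frac1{N_1}B_1}*\delta_{\frac1{N_1N_2}B_2}*\delta_{\frac1{N_1N_2N_3}B_3}*\cdots,$$ that is, the weak limit of the finite convolutions $\delta_{\frac1{N_1}B_1}*\cdots*\delta_{\frac1{N_1\cdots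 N_n}B_n}$ as $n\to\infty$, exists as a unique Borel probability measure on $\mathbb R$; it is spectral, and it admits a spectrum $\Lambda\subset\mathbb Z$. -/

import Mathlib

open MeasureTheory Filter Topology
open scoped BoundedContinuousFunction

/-- The matrix `(#B)^{-1/2} [exp(-2πi b l / N)]`, rows indexed by `b ∈ B`, columns by `l ∈ L`. -/
noncomputable def hadamardMatrix (N : ℕ) (B L : Finset ℤ) : Matrix B L ℂ :=
  Matrix.of fun b l =>
    ((1 / Real.sqrt (B.card : ℝ) : ℝ) : ℂ) *
      Complex.exp (-2 * Real.pi * Complex.I * (((b : ℤ) : ℂ) * ((l : ℤ) : ℂ) / (N : ℂ)))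

/-- `(N, B, L)` is a Hadamard triple: `N ≥ 2`, `B` and `L` are (nonempty) finite sets of integers
of the same cardinality `M ≤ N`, and the associated (square) matrix `H` satisfies `H* H = I`. -/
structure IsHadamardTriple (N : ℕ) (B L : Finset ℤ) : Prop where
  two_le : 2 ≤ N
  nonempty : B.Nonempty
  card_eq : L.card = B.card
  card_le : B.card ≤ N
  unitary : (hadamardMatrix N B L).conjTranspose * hadamardMatrix N B L = 1

/-- `δ_A = (1 / #A) ∑_{a ∈ A} δ_a` for a finite set `A` of reals. -/
noncomputable def uniformDirac (A : Finset ℝ) : Measure ℝ :=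
  (A.card : ENNReal)⁻¹ • ∑ a ∈ A, Measure.dirac a

/-- The set `(1 / c) B = {b / c : b ∈ B}`. -/
noncomputable def scaledSet (c : ℝ) (B : Finset ℤ) : Finset ℝ :=
  B.image fun b : ℤ => (b : ℝ) / c

/-- The convolution of the first `n` of the measures `δ_{B_k / (N_0 ⋯ N_k)}`, `k = 0, 1, …`
(sequences are indexed from `0`; the empty convolution is `δ_0`). -/
noncomputable def partialConvolution (N : ℕ → ℕ) (B : ℕ → Finset ℤ) : ℕ → Measure ℝ
  | 0 => Measure.dirac 0
  | n + 1 => Measure.conv (partialConvolution N B n)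
      (uniformDirac (scaledSet (∏ i ∈ Finset.range (n + 1), (N i : ℝ)) (B n)))

/-- `μ` is the infinite convolution of the measures `δ_{B_k / (N_0 ⋯ N_k)}`, `k = 0, 1, …`, that
is, the limit of the finite convolutions in the sense of weak convergence (against all bounded
continuous functions). -/
def IsCantorMoranMeasure (N : ℕ → ℕ) (B : ℕ → Finset ℤ) (μ : ProbabilityMeasure ℝ) : Prop :=
  ∀ f : ℝ →ᵇ ℝ,
    Tendsto (fun n => ∫ x, f x ∂(partialConvolution N B n)) atTop (𝓝 (∫ x, f x ∂(μ : Measure ℝ)))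

/-- The exponential function `x ↦ exp(2πi t x)`. -/
noncomputable def expFun (t : ℝ) (x : ℝ) : ℂ :=
  Complex.exp (2 * Real.pi * Complex.I * ((t : ℂ) * (x : ℂ)))

theorem memLp_expFun (μ : Measure ℝ) [IsFiniteMeasure μ] (t : ℝ) : MemLp (expFun t) 2 μ := by
  refine MemLp.of_bound (C := 1) ?_ (Eventually.of_forall fun x => ?_)
  · exact (by unfold expFun; fun_prop : Continuous (expFun t)).aestronglyMeasurable
  · have h : expFun t x = Complex.exp (((2 * Real.pi * (t * x) : ℝ) : ℂ) * Complex.I) := by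
      unfold expFun
      congr 1
      push_cast
      ring
    rw [h, Complex.norm_exp_ofReal_mul_I]

/-- The exponential function `x ↦ exp(2πi t x)` as an element of `L²(μ)`. -/
noncomputable def expLp (μ : Measure ℝ) [IsFiniteMeasure μ] (t : ℝ) : Lp ℂ 2 μ :=
  (memLp_expFun μ t).toLp (expFun t)

/-- The countable set `S` is a spectrum of `μ`: the exponentials `exp(2πi t x)`, `t ∈ S`, form an
orthonormal (Hilbert) basis of `L²(μ)`. -/
def IsSpectrum (μ : Measure ℝ) [IsFiniteMeasure μ] (S : Set ℝ) : Prop :=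
  S.Countable ∧ ∃ b : HilbertBasis S ℂ (Lp ℂ 2 μ), ∀ t : S, b t = expLp μ t

/-- `μ` is a spectral measure: it has a spectrum. -/
def IsSpectralMeasure (μ : Measure ℝ) [IsFiniteMeasure μ] : Prop :=
  ∃ S : Set ℝ, IsSpectrum μ S

/-!
Write `P_n = N_0 ⋯ N_{n-1}` (`scale`) and `F_n` (`partialTransform`) for the Fourier transform of the
`n`-th finite convolution, a product of rescaled masks `m_{B_i}`. Since `B_i ⊆ [0, N_i)`, all the
finite convolutions live on `[0, 1]`; hence they are tight, `F_n` is `2π`-Lipschitz, and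
`|F_n(y)| ≥ cos(π y)` for `|y| ≤ 1/2`. Tightness and pointwise convergence of `F_n` give the weak
limit `μ` (`exists_isCantorMoranMeasure`). Its transform factors as `F_n(t)` times the transform of
the rescaled tail at `t / P_n`, where the tail is again a Cantor–Moran measure.

A finite set `Λ` of integers is a spectrum of the `n`-th convolution when
`∑_{λ ∈ Λ} |F_n(x + λ)|² = 1` for all `x`. The Hadamard condition yields
`∑_{l ∈ L_n} |m_{B_n}((x + l) / N_n)|² = 1`, so `Λ + P_n L_n` is then a spectrum for `n + 1`, and as
`F_n` has period `P_n`, the elements of a spectrum may be moved by multiples of `P_n`. This freedom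
serves to bound the tail transforms below on the spectrum, uniformly in the stage. The identity for
`F_n` then passes to `μ` by dominated convergence (`IsCantorMoranMeasure.hasSum_indicator`), and
since exponentials separate finite measures, it makes the union of the nested spectra a spectrum of
`μ` (`isSpectrum_of_hasSum`).

The uniform lower bound is `exists_int_le_norm_partialTransform`: every class of `ℝ / ℤ` contains a
point where the tail transform is at least `1 / (2 #B)`, with `B` the first digit set of the tail.
The cosine bound by itself degenerates at the class of `1/2`. One instead uses it for the tail
without its first factor, at the points `y_j = (x + j) / N`, and needs some `j` for which
`|m_B(y_j)| |cos(π y_j)| ≥ 1 / (2 #B)`. As `2 |cos(π y)| = |1 + exp(2πi y)|`, this follows by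
extracting the coefficient of `exp(2πi d y)`, `d = max B`, from the trigonometric polynomial
`#B m_B(y) (1 + exp(2πi y))`: the sum over a full period has modulus at least `N`. Stages with
bounded `#B` recur infinitely often, because the lower limit of `#B_n` is finite.
-/

/-! ### Exponentials and the Fourier transform of a measure -/

theorem expFun_eq_exp_ofReal_mul_I (t x : ℝ) :
    expFun t x = Complex.exp (((2 * Real.pi * (t * x) : ℝ) : ℂ) * Complex.I) := by
  unfold expFun
  congr 1
  push_cast
  ring

theorem norm_expFun (t x : ℝ) : ‖expFun t x‖ = 1 := by
  rw [expFun_eq_exp_ofReal_mul_I, Complex.norm_exp_ofReal_mul_I]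

theorem expFun_add_left (s t x : ℝ) : expFun (s + t) x = expFun s x * expFun t x := by
  unfold expFun
  rw [← Complex.exp_add]
  congr 1
  push_cast
  ring

theorem expFun_add_right (t x y : ℝ) : expFun t (x + y) = expFun t x * expFun t y := by
  unfold expFun
  rw [← Complex.exp_add]
  congr 1
  push_cast
  ring

@[simp] theorem expFun_zero_left (x : ℝ) : expFun 0 x = 1 := by
  simp [expFun]

@[simp] theorem expFun_zero_right (t : ℝ) : expFun t 0 = 1 := by
  simp [expFun]

theorem expFun_int_int (m n : ℤ) : expFun (m : ℝ) (n : ℝ) = 1 := by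
  unfold expFun
  rw [Complex.exp_eq_one_iff]
  exact ⟨m * n, by push_cast; ring⟩

theorem conj_expFun (t x : ℝ) : (starRingEnd ℂ) (expFun t x) = expFun (-t) x := by
  unfold expFun
  rw [← Complex.exp_conj]
  congr 1
  simp only [map_mul, Complex.conj_I, Complex.conj_ofReal, map_ofNat]
  push_cast
  ring

theorem continuous_expFun (t : ℝ) : Continuous (expFun t) := by
  unfold expFun
  fun_prop

theorem integrable_expFun (μ : Measure ℝ) [IsFiniteMeasure μ] (t : ℝ) :
    Integrable (expFun t) μ :=
  (memLp_expFun μ t).integrable (by norm_num)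

theorem norm_expFun_sub_le (s t x : ℝ) :
    ‖expFun s x - expFun t x‖ ≤ 2 * Real.pi * |s - t| * |x| := by
  have h : expFun s x - expFun t x = expFun t x * (expFun (s - t) x - 1) := by
    rw [mul_sub, ← expFun_add_left]
    ring_nf
  rw [h, norm_mul, norm_expFun, one_mul, expFun_eq_exp_ofReal_mul_I, mul_comm _ Complex.I]
  refine (Real.norm_exp_I_mul_ofReal_sub_one_le).trans (le_of_eq ?_)
  rw [Real.norm_eq_abs, abs_mul, abs_mul, abs_mul, abs_two, abs_of_pos Real.pi_pos]
  ring

/-- The Fourier transform `t ↦ ∫ exp(2πi t x) dμ(x)` of a measure on the line. -/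
noncomputable def expIntegral (μ : Measure ℝ) (t : ℝ) : ℂ :=
  ∫ x, expFun t x ∂μ

theorem expIntegral_eq_charFun (μ : Measure ℝ) (t : ℝ) :
    expIntegral μ t = charFun μ (2 * Real.pi * t) := by
  rw [charFun_apply_real, expIntegral]
  refine integral_congr_ae (Eventually.of_forall fun x => ?_)
  simp only [expFun]
  congr 1
  push_cast
  ring

theorem charFun_eq_expIntegral (μ : Measure ℝ) (t : ℝ) :
    charFun μ t = expIntegral μ (t / (2 * Real.pi)) := by
  rw [expIntegral_eq_charFun, mul_div_cancel₀ _ (by positivity)]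

theorem expIntegral_conv (μ ν : Measure ℝ) [IsFiniteMeasure μ] [IsFiniteMeasure ν] (t : ℝ) :
    expIntegral (μ.conv ν) t = expIntegral μ t * expIntegral ν t := by
  simp only [expIntegral_eq_charFun, charFun_conv]

theorem expIntegral_zero (μ : Measure ℝ) [IsProbabilityMeasure μ] : expIntegral μ 0 = 1 := by
  simp [expIntegral]

theorem norm_one_add_expFun_one (y : ℝ) : ‖1 + expFun 1 y‖ = 2 * |Real.cos (Real.pi * y)| := by
  have h : 1 + expFun 1 y = expFun 1 (y / 2) * (((2 * Real.cos (Real.pi * y) : ℝ) : ℂ)) := by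
    push_cast
    rw [Complex.two_cos, expFun_eq_exp_ofReal_mul_I, expFun_eq_exp_ofReal_mul_I, mul_add,
      ← Complex.exp_add, ← Complex.exp_add, add_comm]
    congr 1
    · congr 1
      push_cast
      ring
    · symm
      rw [Complex.exp_eq_one_iff]
      exact ⟨0, by push_cast; ring⟩
  rw [h, norm_mul, norm_expFun, one_mul, Complex.norm_real, Real.norm_eq_abs, abs_mul, abs_two]

/-- For `|y| ≤ 1/2` the points `exp(2πi y x)`, `x ∈ [0, 1]`, lie on an arc of length at most `π`,
so their mean has modulus at least the cosine of half the arc. -/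
theorem cos_le_norm_expIntegral {ν : Measure ℝ} [IsProbabilityMeasure ν]
    (hν : ∀ᵐ x ∂ν, x ∈ Set.Icc (0 : ℝ) 1) {y : ℝ} (hy : |y| ≤ 1 / 2) :
    Real.cos (Real.pi * y) ≤ ‖expIntegral ν y‖ := by
  -- Rotating by `exp(-πi y)` makes the arc symmetric about `1`.
  have h1 : expFun (-y) (1 / 2) * expIntegral ν y = ∫ x, expFun y (x - 1 / 2) ∂ν := by
    unfold expIntegral
    rw [← integral_const_mul]
    refine integral_congr_ae (Eventually.of_forall fun x => ?_)
    simp only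
    rw [← conj_expFun, sub_eq_add_neg, expFun_add_right, mul_comm, conj_expFun]
    congr 1
    unfold expFun
    congr 1
    push_cast
    ring
  have hint : Integrable (fun x => expFun y (x - 1 / 2)) ν := by
    refine Integrable.of_bound (C := 1) ?_ (Eventually.of_forall fun x => (norm_expFun _ _).le)
    exact ((continuous_expFun y).comp (continuous_id.sub continuous_const)).aestronglyMeasurable
  have h2 : ‖expIntegral ν y‖ = ‖∫ x, expFun y (x - 1 / 2) ∂ν‖ := by
    rw [← h1, norm_mul, norm_expFun, one_mul]
  rw [h2]
  refine le_trans ?_ (Complex.re_le_norm _)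
  have h3 : (∫ x, expFun y (x - 1 / 2) ∂ν).re = ∫ x, (expFun y (x - 1 / 2)).re ∂ν :=
    (integral_re hint).symm
  rw [h3]
  have h4 : Real.cos (Real.pi * y) = ∫ _x, Real.cos (Real.pi * y) ∂ν := by simp
  rw [h4]
  refine integral_mono_ae (integrable_const _) hint.re ?_
  filter_upwards [hν] with x hx
  change _ ≤ (expFun y (x - 1 / 2)).re
  rw [expFun_eq_exp_ofReal_mul_I, Complex.exp_ofReal_mul_I_re]
  rw [← Real.cos_abs (Real.pi * y), ← Real.cos_abs (2 * Real.pi * _)]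
  have hpi := Real.pi_pos
  have hx' : |x - 1 / 2| ≤ 1 / 2 := abs_le.2 ⟨by linarith [hx.1], by linarith [hx.2]⟩
  apply Real.cos_le_cos_of_nonneg_of_le_pi (abs_nonneg _)
  · rw [abs_mul, abs_of_pos hpi]
    nlinarith
  · simp only [abs_mul, abs_two, abs_of_pos hpi]
    nlinarith [mul_le_mul_of_nonneg_left hx' (mul_nonneg hpi.le (abs_nonneg y))]

theorem norm_expIntegral_sub_le {ν : Measure ℝ} [IsProbabilityMeasure ν]
    (hν : ∀ᵐ x ∂ν, x ∈ Set.Icc (0 : ℝ) 1) (s t : ℝ) :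
    ‖expIntegral ν s - expIntegral ν t‖ ≤ 2 * Real.pi * |s - t| := by
  unfold expIntegral
  rw [← integral_sub (integrable_expFun ν s) (integrable_expFun ν t)]
  have h : ∀ᵐ x ∂ν, ‖expFun s x - expFun t x‖ ≤ 2 * Real.pi * |s - t| := by
    filter_upwards [hν] with x hx
    refine (norm_expFun_sub_le s t x).trans ?_
    have hx' : |x| ≤ 1 := abs_le.2 ⟨by linarith [hx.1], hx.2⟩
    exact mul_le_of_le_one_right (by positivity) hx'
  simpa using norm_integral_le_of_norm_le_const h

/-! ### Masks and the orthogonality relations of a Hadamard triple -/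

/-- The mask `y ↦ (#B)⁻¹ ∑_{b ∈ B} exp(2πi b y)` of a finite set of integers, that is, the Fourier
transform of the uniform measure on `B`. -/
noncomputable def mask (B : Finset ℤ) (y : ℝ) : ℂ :=
  (B.card : ℂ)⁻¹ * ∑ b ∈ B, expFun (b : ℝ) y

theorem mask_add_int (B : Finset ℤ) (y : ℝ) (k : ℤ) : mask B (y + k) = mask B y := by
  unfold mask
  congr 1
  refine Finset.sum_congr rfl fun b _ => ?_
  rw [expFun_add_right, expFun_int_int, mul_one]

theorem expIntegral_uniformDirac (A : Finset ℝ) (t : ℝ) :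
    expIntegral (uniformDirac A) t = (A.card : ℂ)⁻¹ * ∑ a ∈ A, expFun t a := by
  unfold expIntegral uniformDirac
  rw [integral_smul_measure, integral_finsetSum_measure]
  · simp
  · intro a _
    exact integrable_expFun _ t

theorem expIntegral_uniformDirac_scaledSet {c : ℝ} (hc : c ≠ 0) (B : Finset ℤ) (t : ℝ) :
    expIntegral (uniformDirac (scaledSet c B)) t = mask B (t / c) := by
  have hinj : Function.Injective fun b : ℤ => (b : ℝ) / c := by
    intro a b h
    have h' : (a : ℝ) / c = (b : ℝ) / c := h
    rw [div_left_inj' hc] at h'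
    exact_mod_cast h'
  rw [expIntegral_uniformDirac, mask, scaledSet, Finset.card_image_of_injective _ hinj,
    Finset.sum_image hinj.injOn]
  congr 1
  refine Finset.sum_congr rfl fun b _ => ?_
  unfold expFun
  congr 1
  push_cast
  ring

instance isFiniteMeasure_uniformDirac (A : Finset ℝ) : IsFiniteMeasure (uniformDirac A) := by
  refine ⟨?_⟩
  unfold uniformDirac
  rcases A.eq_empty_or_nonempty with rfl | h
  · simp
  · simp [ENNReal.inv_mul_cancel, h.card_pos.ne']

theorem isProbabilityMeasure_uniformDirac {A : Finset ℝ} (h : A.Nonempty) :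
    IsProbabilityMeasure (uniformDirac A) := by
  refine ⟨?_⟩
  unfold uniformDirac
  simp [ENNReal.inv_mul_cancel, h.card_pos.ne']

theorem ae_uniformDirac (A : Finset ℝ) : ∀ᵐ x ∂(uniformDirac A), x ∈ A := by
  rw [ae_iff]
  unfold uniformDirac
  have : MeasurableSet {x | ¬ x ∈ A} := (A.measurableSet).compl
  simp only [Measure.smul_apply, Measure.finsetSum_apply, Measure.dirac_apply' _ this, smul_eq_mul]
  rw [Finset.sum_eq_zero, mul_zero]
  intro a ha
  simp [ha]

/-- The rows of a Hadamard matrix are orthogonal as well, since the matrix is square. Hence it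
preserves the norm of the vector `(exp(-2πi b x / N))_b`, whose image has entries of modulus
`√M |m_B((x + l) / N)|`. -/
theorem IsHadamardTriple.sum_norm_mask_sq {N : ℕ} {B L : Finset ℤ} (h : IsHadamardTriple N B L)
    (x : ℝ) : ∑ l ∈ L, ‖mask B ((x + l) / N)‖ ^ 2 = 1 := by
  classical
  have hcard : Fintype.card L = Fintype.card B := by simpa using h.card_eq
  have e : L ≃ B := Fintype.equivOfCardEq hcard
  set H := hadamardMatrix N B L with hH
  have hHH : H * H.conjTranspose = 1 := (Matrix.mul_eq_one_comm_of_equiv e).1 h.unitary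
  have hM : (0 : ℝ) < B.card := by exact_mod_cast h.nonempty.card_pos
  set v : B → ℂ := fun b => expFun (-((b : ℤ) : ℝ)) (x / N) with hv
  have hw : ∀ l : L, ‖(Matrix.vecMul v H) l‖ ^ 2 = B.card * ‖mask B ((x + (l : ℤ)) / N)‖ ^ 2 := by
    intro l
    have : (Matrix.vecMul v H) l =
        ((1 / Real.sqrt (B.card : ℝ) : ℝ) : ℂ) *
          (starRingEnd ℂ) (∑ b ∈ B, expFun (b : ℝ) ((x + (l : ℤ)) / N)) := by
      rw [map_sum, ← Finset.sum_coe_sort B, Finset.mul_sum]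
      simp only [Matrix.vecMul, dotProduct, hv, hH, hadamardMatrix, Matrix.of_apply]
      refine Finset.sum_congr rfl fun b _ => ?_
      rw [mul_left_comm, conj_expFun]
      congr 1
      unfold expFun
      rw [← Complex.exp_add]
      congr 1
      push_cast
      ring
    rw [this, mask, norm_mul, norm_mul, RCLike.norm_conj, Complex.norm_real, Real.norm_eq_abs,
      mul_pow, mul_pow, sq_abs, div_pow, Real.sq_sqrt hM.le, norm_inv, Complex.norm_natCast]
    field_simp
  have hstar : ∀ {ι : Type} [Fintype ι] (u : ι → ℂ),
      dotProduct u (star u) = ((∑ i, ‖u i‖ ^ 2 : ℝ) : ℂ) := by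
    intro ι _ u
    simp [dotProduct, Complex.mul_conj, Complex.normSq_eq_norm_sq]
  have hkey : ((∑ l, ‖(Matrix.vecMul v H) l‖ ^ 2 : ℝ) : ℂ) = ((∑ b, ‖v b‖ ^ 2 : ℝ) : ℂ) := by
    rw [← hstar, ← hstar, Matrix.star_vecMul, Matrix.dotProduct_mulVec, Matrix.vecMul_vecMul, hHH,
      Matrix.vecMul_one]
  have hkey' := Complex.ofReal_injective hkey
  simp only [hw, ← Finset.mul_sum] at hkey'
  rw [Finset.sum_coe_sort L (fun l => ‖mask B ((x + l) / N)‖ ^ 2)] at hkey'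
  refine mul_left_cancel₀ hM.ne' (hkey'.trans ?_)
  simp [hv, norm_expFun]

/-- The representatives in a Hadamard triple may be taken to contain `0`. -/
theorem IsHadamardTriple.exists_zero_mem {N : ℕ} {B L : Finset ℤ} (h : IsHadamardTriple N B L) :
    ∃ L' : Finset ℤ, 0 ∈ L' ∧ ∀ x : ℝ, ∑ l ∈ L', ‖mask B ((x + l) / N)‖ ^ 2 = 1 := by
  have hL : L.Nonempty := by
    rw [← Finset.card_pos, h.card_eq]
    exact h.nonempty.card_pos
  obtain ⟨l₀, hl₀⟩ := hL
  refine ⟨L.image (· - l₀), Finset.mem_image.2 ⟨l₀, hl₀, sub_self _⟩, fun x => ?_⟩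
  rw [Finset.sum_image (sub_left_injective.injOn)]
  rw [← h.sum_norm_mask_sq (x - l₀)]
  refine Finset.sum_congr rfl fun l _ => ?_
  congr 4
  push_cast
  ring

theorem sum_range_expFun_div {N : ℕ} (hN : N ≠ 0) {c : ℤ} (hc : ¬ (N : ℤ) ∣ c) (x : ℝ) :
    ∑ j ∈ Finset.range N, expFun (c : ℝ) ((x + j) / N) = 0 := by
  have hN' : (N : ℂ) ≠ 0 := by exact_mod_cast hN
  set z := expFun (c : ℝ) (1 / N) with hz
  have hterm : ∀ j : ℕ, expFun (c : ℝ) ((x + j) / N) = expFun (c : ℝ) (x / N) * z ^ j := by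
    intro j
    rw [hz, add_div, expFun_add_right]
    congr 1
    unfold expFun
    rw [← Complex.exp_nat_mul]
    congr 1
    push_cast
    ring
  have hz1 : z ≠ 1 := by
    intro h1
    rw [hz, expFun, Complex.exp_eq_one_iff] at h1
    obtain ⟨n, hn⟩ := h1
    apply hc
    refine ⟨n, ?_⟩
    have hpi : (2 * (Real.pi : ℂ) * Complex.I) ≠ 0 := Complex.two_pi_I_ne_zero
    rw [mul_comm (n : ℂ)] at hn
    have h2 := mul_left_cancel₀ hpi hn
    push_cast at h2
    field_simp at h2
    have h3 : ((c : ℤ) : ℂ) = ((N * n : ℤ) : ℂ) := by push_cast; rw [← h2]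
    exact_mod_cast h3
  have hzN : z ^ N = 1 := by
    rw [hz, expFun, ← Complex.exp_nat_mul, Complex.exp_eq_one_iff]
    refine ⟨c, ?_⟩
    push_cast
    field_simp
  simp only [hterm, ← Finset.mul_sum]
  rw [geom_sum_eq hz1, hzN]
  simp

/-- Among the translates of `x / N` by multiples of `1 / N` there is one at which neither the mask
of `B` nor `1 + exp(2πi y)` is small, with a bound that depends on `#B` only. -/
theorem exists_one_le_norm_mask_mul {N : ℕ} {B : Finset ℤ} (hN : 2 ≤ N) (hne : B.Nonempty)
    (hB : B ⊆ Finset.Ico (0 : ℤ) N) (x : ℝ) :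
    ∃ j : ℕ, 1 ≤ B.card * (‖mask B ((x + j) / N)‖ * ‖1 + expFun 1 ((x + j) / N)‖) := by
  by_contra! hcon
  have hM : (B.card : ℂ) ≠ 0 := by exact_mod_cast hne.card_pos.ne'
  have hN0 : N ≠ 0 := by omega
  set d := B.max' hne with hd
  have hdB : d ∈ B := B.max'_mem hne
  have hdI := Finset.mem_Ico.1 (hB hdB)
  -- The coefficient of `exp(2πi d y)`, `d = max B`, in `(∑_b exp(2πi b y)) (1 + exp(2πi y))` is at
  -- least `1`; it is extracted by summing over a full period.
  set T : ℂ := ∑ j ∈ Finset.range N, (B.card * (mask B ((x + j) / N) *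
    (1 + expFun 1 ((x + j) / N)))) * expFun (-(d : ℝ)) ((x + j) / N) with hT
  have hlt : ‖T‖ < N := by
    refine (norm_sum_le _ _).trans_lt ?_
    refine lt_of_lt_of_eq (b := ∑ _j ∈ Finset.range N, (1 : ℝ)) ?_ (by simp)
    refine Finset.sum_lt_sum_of_nonempty (Finset.nonempty_range_iff.2 hN0) fun j _ => ?_
    rw [norm_mul, norm_expFun, mul_one, norm_mul, norm_mul, Complex.norm_natCast]
    exact hcon j
  have hTsum : T = ∑ b ∈ B, (∑ j ∈ Finset.range N, expFun ((b - d : ℤ) : ℝ) ((x + j) / N) +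
      ∑ j ∈ Finset.range N, expFun ((b + 1 - d : ℤ) : ℝ) ((x + j) / N)) := by
    simp only [← Finset.sum_add_distrib]
    rw [Finset.sum_comm, hT]
    refine Finset.sum_congr rfl fun j _ => ?_
    rw [mask, ← mul_assoc (B.card : ℂ), mul_inv_cancel_left₀ hM, Finset.sum_mul, Finset.sum_mul]
    refine Finset.sum_congr rfl fun b _ => ?_
    rw [mul_add, mul_one, add_mul, ← expFun_add_left, ← expFun_add_left, ← expFun_add_left]
    push_cast
    rfl
  have h0 : ∀ {c : ℤ}, c = 0 → ∑ j ∈ Finset.range N, expFun (c : ℝ) ((x + j) / N) = N := by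
    rintro c rfl
    simp
  have hA : ∀ b ∈ B, ∑ j ∈ Finset.range N, expFun ((b - d : ℤ) : ℝ) ((x + j) / N) =
      if b = d then (N : ℂ) else 0 := by
    intro b hb
    have hbI := Finset.mem_Ico.1 (hB hb)
    have hbd : b ≤ d := B.le_max' b hb
    split_ifs with hbd'
    · exact h0 (by omega)
    · refine sum_range_expFun_div hN0 (fun hdvd => hbd' ?_) x
      have := Int.eq_zero_of_abs_lt_dvd hdvd (by rw [abs_lt]; omega)
      omega
  have hA' : ∀ b ∈ B, ∑ j ∈ Finset.range N, expFun ((b + 1 - d : ℤ) : ℝ) ((x + j) / N) =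
      if b + 1 = d then (N : ℂ) else 0 := by
    intro b hb
    have hbI := Finset.mem_Ico.1 (hB hb)
    have hbd : b ≤ d := B.le_max' b hb
    split_ifs with hbd'
    · exact h0 (by omega)
    · refine sum_range_expFun_div hN0 (fun hdvd => hbd' ?_) x
      have := Int.eq_zero_of_abs_lt_dvd hdvd (by rw [abs_lt]; omega)
      omega
  have hTval : T = ((N * (1 + (B.filter fun b => b + 1 = d).card) : ℕ) : ℂ) := by
    rw [hTsum, Finset.sum_congr rfl fun b hb => by rw [hA b hb, hA' b hb], Finset.sum_add_distrib,
      Finset.sum_ite_eq' B d, if_pos hdB, ← Finset.sum_filter, Finset.sum_const, nsmul_eq_mul]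
    push_cast
    ring
  rw [hTval, Complex.norm_natCast] at hlt
  have hlt' : N * (1 + (B.filter fun b => b + 1 = d).card) < N := by exact_mod_cast hlt
  nlinarith

/-! ### Finite convolutions -/

/-- The product `N_0 ⋯ N_{n-1}`, as a real number. -/
noncomputable def scale (N : ℕ → ℕ) (n : ℕ) : ℝ := ∏ i ∈ Finset.range n, (N i : ℝ)

theorem scale_succ (N : ℕ → ℕ) (n : ℕ) : scale N (n + 1) = scale N n * N n :=
  Finset.prod_range_succ _ _

theorem scale_zero (N : ℕ → ℕ) : scale N 0 = 1 := by simp [scale]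

theorem scale_add (N : ℕ → ℕ) (n m : ℕ) :
    scale N (n + m) = scale N n * scale (fun i => N (n + i)) m :=
  Finset.prod_range_add _ _ _

theorem scale_eq_intCast (N : ℕ → ℕ) (n : ℕ) :
    scale N n = ((∏ i ∈ Finset.range n, (N i : ℤ) : ℤ) : ℝ) := by
  simp [scale]

theorem two_pow_le_scale {N : ℕ → ℕ} (hN : ∀ n, 2 ≤ N n) (n : ℕ) : (2 : ℝ) ^ n ≤ scale N n := by
  induction n with
  | zero => simp [scale]
  | succ n ih =>
    rw [scale_succ, pow_succ]
    have : (2 : ℝ) ≤ N n := by exact_mod_cast hN n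
    exact mul_le_mul ih this (by norm_num) (le_trans (by positivity) ih)

theorem scale_pos {N : ℕ → ℕ} (hN : ∀ n, 2 ≤ N n) (n : ℕ) : 0 < scale N n :=
  lt_of_lt_of_le (by positivity) (two_pow_le_scale hN n)

theorem tendsto_scale_atTop {N : ℕ → ℕ} (hN : ∀ n, 2 ≤ N n) : Tendsto (scale N) atTop atTop :=
  tendsto_atTop_mono (two_pow_le_scale hN) (tendsto_pow_atTop_atTop_of_one_lt (by norm_num))

theorem scaledSet_nonempty {c : ℝ} {B : Finset ℤ} (h : B.Nonempty) : (scaledSet c B).Nonempty :=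
  h.image _

theorem isProbabilityMeasure_partialConvolution (N : ℕ → ℕ) {B : ℕ → Finset ℤ}
    (hB : ∀ n, (B n).Nonempty) (n : ℕ) : IsProbabilityMeasure (partialConvolution N B n) := by
  induction n with
  | zero =>
    rw [partialConvolution]
    infer_instance
  | succ n ih =>
    rw [partialConvolution]
    have := isProbabilityMeasure_uniformDirac
      (scaledSet_nonempty (c := ∏ i ∈ Finset.range (n + 1), (N i : ℝ)) (hB n))
    infer_instance

/-- The digits satisfy `b ≤ N_k - 1`, so the largest point of the support telescopes. -/
theorem ae_partialConvolution_mem_Icc {N : ℕ → ℕ} {B : ℕ → Finset ℤ} (hN : ∀ n, 2 ≤ N n)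
    (hne : ∀ n, (B n).Nonempty) (hB : ∀ n, B n ⊆ Finset.Ico (0 : ℤ) (N n)) (n : ℕ) :
    ∀ᵐ x ∂(partialConvolution N B n), x ∈ Set.Icc 0 (1 - (scale N n)⁻¹) := by
  induction n with
  | zero =>
    rw [partialConvolution, scale_zero, ae_dirac_eq]
    simp
  | succ n ih =>
    have := isProbabilityMeasure_partialConvolution N hne n
    rw [partialConvolution, Measure.conv]
    refine (ae_map_iff (p := fun x => x ∈ Set.Icc 0 (1 - (scale N (n + 1))⁻¹)) (by fun_prop)
      measurableSet_Icc).2 ?_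
    have h1 := Measure.quasiMeasurePreserving_fst (μ := partialConvolution N B n)
      (ν := uniformDirac (scaledSet (∏ i ∈ Finset.range (n + 1), (N i : ℝ)) (B n))) |>.ae ih
    have h2 := Measure.quasiMeasurePreserving_snd (μ := partialConvolution N B n)
      (ν := uniformDirac (scaledSet (∏ i ∈ Finset.range (n + 1), (N i : ℝ)) (B n))) |>.ae
        (ae_uniformDirac _)
    filter_upwards [h1, h2] with p hp1 hp2
    obtain ⟨b, hb, hb'⟩ := Finset.mem_image.1 hp2
    have hbI := Finset.mem_Ico.1 (hB n hb)
    have hb0 : (0 : ℝ) ≤ b := by exact_mod_cast hbI.1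
    have hb1 : (b : ℝ) ≤ N n - 1 := by
      have : b + 1 ≤ (N n : ℤ) := hbI.2
      have : (b : ℝ) + 1 ≤ N n := by exact_mod_cast this
      linarith
    change (b : ℝ) / scale N (n + 1) = p.2 at hb'
    have hP := scale_pos hN n
    have hP1 := scale_pos hN (n + 1)
    have hNn : (0 : ℝ) < N n := by
      have := hN n
      positivity
    rw [← hb']
    constructor
    · exact add_nonneg hp1.1 (div_nonneg hb0 hP1.le)
    · have h3 : (b : ℝ) / scale N (n + 1) ≤ (N n - 1) / scale N (n + 1) :=
        div_le_div_of_nonneg_right hb1 hP1.le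
      have h4 : (N n - 1 : ℝ) / scale N (n + 1) = (scale N n)⁻¹ - (scale N (n + 1))⁻¹ := by
        rw [scale_succ]
        field_simp
      linarith [hp1.2]

theorem ae_partialConvolution_mem_unit {N : ℕ → ℕ} {B : ℕ → Finset ℤ} (hN : ∀ n, 2 ≤ N n)
    (hne : ∀ n, (B n).Nonempty) (hB : ∀ n, B n ⊆ Finset.Ico (0 : ℤ) (N n)) (n : ℕ) :
    ∀ᵐ x ∂(partialConvolution N B n), x ∈ Set.Icc (0 : ℝ) 1 := by
  filter_upwards [ae_partialConvolution_mem_Icc hN hne hB n] with x hx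
  exact ⟨hx.1, hx.2.trans (sub_le_self _ (inv_nonneg.2 (scale_pos hN n).le))⟩

/-- The Fourier transform of the `n`-th finite convolution. -/
noncomputable def partialTransform (N : ℕ → ℕ) (B : ℕ → Finset ℤ) (n : ℕ) (t : ℝ) : ℂ :=
  expIntegral (partialConvolution N B n) t

theorem partialTransform_zero (N : ℕ → ℕ) (B : ℕ → Finset ℤ) (t : ℝ) :
    partialTransform N B 0 t = 1 := by
  simp [partialTransform, partialConvolution, expIntegral]

theorem partialTransform_succ {N : ℕ → ℕ} {B : ℕ → Finset ℤ} (hN : ∀ n, 2 ≤ N n)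
    (hne : ∀ n, (B n).Nonempty) (n : ℕ) (t : ℝ) :
    partialTransform N B (n + 1) t =
      partialTransform N B n t * mask (B n) (t / scale N (n + 1)) := by
  have := isProbabilityMeasure_partialConvolution N hne n
  rw [partialTransform, partialConvolution, expIntegral_conv]
  rw [← expIntegral_uniformDirac_scaledSet (scale_pos hN (n + 1)).ne']
  rfl

theorem partialTransform_eq_prod {N : ℕ → ℕ} {B : ℕ → Finset ℤ} (hN : ∀ n, 2 ≤ N n)
    (hne : ∀ n, (B n).Nonempty) (n : ℕ) (t : ℝ) :
    partialTransform N B n t = ∏ i ∈ Finset.range n, mask (B i) (t / scale N (i + 1)) := by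
  induction n with
  | zero => simp [partialTransform_zero]
  | succ n ih => rw [partialTransform_succ hN hne, ih, Finset.prod_range_succ]

theorem partialTransform_at_zero (N : ℕ → ℕ) {B : ℕ → Finset ℤ} (hne : ∀ n, (B n).Nonempty)
    (n : ℕ) : partialTransform N B n 0 = 1 :=
  have := isProbabilityMeasure_partialConvolution N hne n
  expIntegral_zero _

theorem partialTransform_add {N : ℕ → ℕ} {B : ℕ → Finset ℤ} (hN : ∀ n, 2 ≤ N n)
    (hne : ∀ n, (B n).Nonempty) (n m : ℕ) (t : ℝ) :
    partialTransform N B (n + m) t = partialTransform N B n t *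
      partialTransform (fun i => N (n + i)) (fun i => B (n + i)) m (t / scale N n) := by
  rw [partialTransform_eq_prod hN hne, partialTransform_eq_prod hN hne,
    partialTransform_eq_prod (fun i => hN (n + i)) (fun i => hne (n + i)), Finset.prod_range_add]
  congr 1
  refine Finset.prod_congr rfl fun i _ => ?_
  rw [add_assoc, scale_add, div_div]

theorem partialTransform_add_scale_mul {N : ℕ → ℕ} {B : ℕ → Finset ℤ} (hN : ∀ n, 2 ≤ N n)
    (hne : ∀ n, (B n).Nonempty) (n : ℕ) (t : ℝ) (k : ℤ) :
    partialTransform N B n (t + scale N n * k) = partialTransform N B n t := by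
  induction n generalizing k with
  | zero => simp [partialTransform_zero]
  | succ n ih =>
    rw [partialTransform_succ hN hne, partialTransform_succ hN hne, add_div,
      mul_div_cancel_left₀ _ (scale_pos hN (n + 1)).ne', mask_add_int, scale_succ, mul_assoc]
    congr 1
    have := ih (N n * k)
    push_cast at this
    exact this

section bounds

variable {N : ℕ → ℕ} {B : ℕ → Finset ℤ}

theorem cos_le_norm_partialTransform (hN : ∀ n, 2 ≤ N n)
    (hne : ∀ n, (B n).Nonempty) (hB : ∀ n, B n ⊆ Finset.Ico (0 : ℤ) (N n)) (n : ℕ) {y : ℝ}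
    (hy : |y| ≤ 1 / 2) : Real.cos (Real.pi * y) ≤ ‖partialTransform N B n y‖ :=
  have := isProbabilityMeasure_partialConvolution N hne n
  cos_le_norm_expIntegral (ae_partialConvolution_mem_unit hN hne hB n) hy

theorem norm_partialTransform_sub_le (hN : ∀ n, 2 ≤ N n)
    (hne : ∀ n, (B n).Nonempty) (hB : ∀ n, B n ⊆ Finset.Ico (0 : ℤ) (N n)) (n : ℕ) (s t : ℝ) :
    ‖partialTransform N B n s - partialTransform N B n t‖ ≤ 2 * Real.pi * |s - t| :=
  have := isProbabilityMeasure_partialConvolution N hne n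
  norm_expIntegral_sub_le (ae_partialConvolution_mem_unit hN hne hB n) s t

theorem half_le_norm_partialTransform (hN : ∀ n, 2 ≤ N n)
    (hne : ∀ n, (B n).Nonempty) (hB : ∀ n, B n ⊆ Finset.Ico (0 : ℤ) (N n)) (n : ℕ) {y : ℝ}
    (hy : |y| ≤ 1 / 3) : 1 / 2 ≤ ‖partialTransform N B n y‖ := by
  refine le_trans ?_ (cos_le_norm_partialTransform hN hne hB n (hy.trans (by norm_num)))
  have hpi := Real.pi_pos
  rw [← Real.cos_pi_div_three, ← Real.cos_abs (Real.pi * y), abs_mul, abs_of_pos hpi]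
  apply Real.cos_le_cos_of_nonneg_of_le_pi (by positivity) (by linarith)
  nlinarith

/-- Equi-positivity. Every class of `ℝ / ℤ` contains a point at which all the finite convolutions
have a Fourier transform bounded below in terms of `#B_0` only. -/
theorem exists_int_le_norm_partialTransform (hN : ∀ n, 2 ≤ N n)
    (hne : ∀ n, (B n).Nonempty) (hB : ∀ n, B n ⊆ Finset.Ico (0 : ℤ) (N n)) (x : ℝ) :
    ∃ k : ℤ, ∀ n, 1 / (2 * (B 0).card : ℝ) ≤ ‖partialTransform N B n (x + k)‖ := by
  obtain ⟨j, hj⟩ := exists_one_le_norm_mask_mul (hN 0) (hne 0) (hB 0) x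
  have hM : (1 : ℝ) ≤ (B 0).card := by exact_mod_cast (hne 0).card_pos
  have hN0 : (N 0 : ℝ) ≠ 0 := by
    have := hN 0
    positivity
  set y : ℝ := (x + j) / N 0 with hy
  set k : ℤ := j - N 0 * round y with hk
  -- The shift by `k` replaces `y` by its representative in `[-1/2, 1/2]`.
  have hxk : (x + k) / N 0 = y + ((-round y : ℤ) : ℝ) := by
    rw [hk, hy]
    push_cast
    field_simp
    ring
  have hy' : |y + ((-round y : ℤ) : ℝ)| ≤ 1 / 2 := by
    push_cast
    rw [← sub_eq_add_neg]
    exact abs_sub_round y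
  have hexp : expFun 1 (y + ((-round y : ℤ) : ℝ)) = expFun 1 y := by
    rw [expFun_add_right]
    have := expFun_int_int 1 (-round y)
    push_cast at this ⊢
    rw [this, mul_one]
  refine ⟨k, fun n => ?_⟩
  cases n with
  | zero =>
    rw [partialTransform_zero, norm_one, div_le_one (by positivity)]
    linarith
  | succ n =>
    have h1 := partialTransform_add hN hne 1 n (x + k)
    rw [partialTransform_succ hN hne 0, partialTransform_zero, one_mul, scale_succ, scale_zero,
      one_mul, hxk, mask_add_int, add_comm 1 n] at h1
    have h2 := cos_le_norm_partialTransform (fun i => hN (1 + i)) (fun i => hne (1 + i))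
      (fun i => hB (1 + i)) n hy'
    have h3 : ‖1 + expFun 1 y‖ / 2 ≤ Real.cos (Real.pi * (y + ((-round y : ℤ) : ℝ))) := by
      rw [← hexp, norm_one_add_expFun_one, abs_of_nonneg]
      · linarith
      · have hpi := Real.pi_pos
        have := abs_le.1 hy'
        exact Real.cos_nonneg_of_neg_pi_div_two_le_of_le (by nlinarith) (by nlinarith)
    rw [h1, norm_mul]
    calc 1 / (2 * (B 0).card : ℝ) ≤ ‖mask (B 0) y‖ * (‖1 + expFun 1 y‖ / 2) := by
          rw [div_le_iff₀ (by positivity)]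
          linarith
      _ ≤ _ := mul_le_mul_of_nonneg_left (h3.trans h2) (norm_nonneg _)

end bounds

/-! ### Spectra of the finite convolutions -/

/-- `Λ` satisfies the Jorgensen–Pedersen criterion `∑_{λ ∈ Λ} |F(x + λ)|² = 1` for the transform `F`
of the `n`-th finite convolution, that is, `Λ` is a spectrum of that measure. -/
def IsPartialSpectrum (N : ℕ → ℕ) (B : ℕ → Finset ℤ) (n : ℕ) (Λ : Finset ℤ) : Prop :=
  ∀ x : ℝ, ∑ l ∈ Λ, ‖partialTransform N B n (x + l)‖ ^ 2 = 1

section spectra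

variable {N : ℕ → ℕ} {B L : ℕ → Finset ℤ} {n : ℕ} {Λ : Finset ℤ}

theorem isPartialSpectrum_zero (N : ℕ → ℕ) (B : ℕ → Finset ℤ) : IsPartialSpectrum N B 0 {0} := by
  intro x
  simp [partialTransform_zero]

theorem IsPartialSpectrum.partialTransform_sub_eq_zero (hne : ∀ n, (B n).Nonempty)
    (h : IsPartialSpectrum N B n Λ) {l l' : ℤ} (hl : l ∈ Λ) (hl' : l' ∈ Λ) (hne' : l ≠ l') :
    partialTransform N B n (l - l' : ℝ) = 0 := by
  have h1 := h (-l')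
  rw [← Finset.add_sum_erase Λ _ hl'] at h1
  simp only [neg_add_cancel, partialTransform_at_zero N hne, norm_one, one_pow] at h1
  have h2 : ∑ x ∈ Λ.erase l', ‖partialTransform N B n (-(l' : ℝ) + x)‖ ^ 2 = 0 := by linarith
  have h3 := (Finset.sum_eq_zero_iff_of_nonneg fun _ _ => by positivity).1 h2 l
    (Finset.mem_erase.2 ⟨hne', hl⟩)
  rw [sub_eq_neg_add]
  simpa using h3

/-- Distinct elements of a spectrum are incongruent modulo the period of the transform. -/
theorem IsPartialSpectrum.eq_of_sub_eq (hN : ∀ n, 2 ≤ N n) (hne : ∀ n, (B n).Nonempty)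
    (h : IsPartialSpectrum N B n Λ) {l l' : ℤ} (hl : l ∈ Λ) (hl' : l' ∈ Λ) {k : ℤ}
    (hk : (l : ℝ) - l' = scale N n * k) : l = l' := by
  by_contra hne'
  have h1 := h.partialTransform_sub_eq_zero hne hl hl' hne'
  have h2 := partialTransform_add_scale_mul hN hne n 0 k
  rw [zero_add, partialTransform_at_zero N hne, ← hk, h1] at h2
  exact zero_ne_one h2

/-- The elements of a spectrum may be moved by multiples of the period of the transform. -/
theorem IsPartialSpectrum.shift (hN : ∀ n, 2 ≤ N n) (hne : ∀ n, (B n).Nonempty)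
    (h : IsPartialSpectrum N B n Λ) (κ : ℤ → ℤ) :
    IsPartialSpectrum N B n (Λ.image fun l => l + (∏ i ∈ Finset.range n, (N i : ℤ)) * κ l) := by
  intro x
  rw [Finset.sum_image]
  · rw [← h x]
    refine Finset.sum_congr rfl fun l _ => ?_
    rw [← partialTransform_add_scale_mul hN hne n (x + l) (κ l), scale_eq_intCast]
    congr 3
    push_cast
    ring
  · intro l hl l' hl' heq
    refine h.eq_of_sub_eq hN hne hl hl' (k := κ l' - κ l) ?_
    have heq' : ((l + (∏ i ∈ Finset.range n, (N i : ℤ)) * κ l : ℤ) : ℝ) =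
      ((l' + (∏ i ∈ Finset.range n, (N i : ℤ)) * κ l' : ℤ) : ℝ) := congrArg _ heq
    rw [scale_eq_intCast]
    rw [Int.cast_add, Int.cast_add, Int.cast_mul, Int.cast_mul] at heq'
    rw [Int.cast_sub]
    linarith

theorem IsPartialSpectrum.succ (hH : ∀ n, IsHadamardTriple (N n) (B n) (L n))
    (h : IsPartialSpectrum N B n Λ) : ∃ Λ', Λ ⊆ Λ' ∧ IsPartialSpectrum N B (n + 1) Λ' := by
  have hN : ∀ n, 2 ≤ N n := fun n => (hH n).two_le
  have hne : ∀ n, (B n).Nonempty := fun n => (hH n).nonempty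
  obtain ⟨L', h0, hL'⟩ := (hH n).exists_zero_mem
  set P : ℤ := ∏ i ∈ Finset.range n, (N i : ℤ) with hP
  have hPs : scale N n = (P : ℝ) := scale_eq_intCast N n
  have hP0 : (P : ℝ) ≠ 0 := hPs ▸ (scale_pos hN n).ne'
  have hNn : (N n : ℝ) ≠ 0 := by
    have := hN n
    positivity
  refine ⟨(Λ ×ˢ L').image fun p => p.1 + P * p.2, fun l hl => ?_, fun x => ?_⟩
  · exact Finset.mem_image.2 ⟨(l, 0), Finset.mk_mem_product hl h0, by simp⟩
  · rw [Finset.sum_image]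
    · rw [Finset.sum_product, ← h x]
      refine Finset.sum_congr rfl fun l _ => ?_
      rw [← mul_one (‖partialTransform N B n (x + l)‖ ^ 2), ← hL' ((x + l) / P), Finset.mul_sum]
      refine Finset.sum_congr rfl fun m _ => ?_
      rw [partialTransform_succ hN hne, norm_mul, mul_pow,
        ← partialTransform_add_scale_mul hN hne n (x + l) m]
      congr 4
      · rw [hPs]
        push_cast
        ring
      · rw [scale_succ, hPs]
        push_cast
        field_simp
        ring
    · rintro ⟨l, m⟩ hp ⟨l', m'⟩ hp' heq
      simp only [Finset.coe_product, Set.mem_prod, Finset.mem_coe] at hp hp'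
      have heq' : ((l + P * m : ℤ) : ℝ) = ((l' + P * m' : ℤ) : ℝ) := congrArg _ heq
      push_cast at heq'
      have hl : l = l' := by
        refine h.eq_of_sub_eq hN hne hp.1 hp'.1 (k := m' - m) ?_
        rw [hPs]
        push_cast
        linarith
      subst hl
      have : (m : ℝ) = m' := mul_left_cancel₀ hP0 (by linarith)
      rw [Prod.mk.injEq]
      exact ⟨rfl, by exact_mod_cast this⟩

theorem IsPartialSpectrum.extend (hH : ∀ n, IsHadamardTriple (N n) (B n) (L n))
    (h : IsPartialSpectrum N B n Λ) {m : ℕ} (hm : n ≤ m) :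
    ∃ Λ', Λ ⊆ Λ' ∧ IsPartialSpectrum N B m Λ' := by
  induction m, hm using Nat.le_induction with
  | base => exact ⟨Λ, subset_rfl, h⟩
  | succ m _ ih =>
    obtain ⟨Λ₁, h1, h2⟩ := ih
    obtain ⟨Λ₂, h3, h4⟩ := h2.succ hH
    exact ⟨Λ₂, h1.trans h3, h4⟩

/-- The transforms of the tail after `n` factors, rescaled by `N_0 ⋯ N_{n-1}`, are at least `ε` in
modulus on `Λ`. -/
def TailBoundedBelow (N : ℕ → ℕ) (B : ℕ → Finset ℤ) (ε : ℝ) (n : ℕ) (Λ : Finset ℤ) : Prop :=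
  ∀ l ∈ Λ, ∀ m, ε ≤ ‖partialTransform (fun i => N (n + i)) (fun i => B (n + i)) m (l / scale N n)‖

/-- A spectrum extends to a spectrum at a later stage on which the tails are bounded below. The
elements already present are kept: the later stage is chosen so late that they are small relative to
its period. The new elements are moved by multiples of the period, by equi-positivity. -/
theorem IsPartialSpectrum.exists_extension (hH : ∀ n, IsHadamardTriple (N n) (B n) (L n))
    (hB : ∀ n, B n ⊆ Finset.Ico (0 : ℤ) (N n)) {M : ℕ} (hM : ∃ᶠ n in atTop, (B n).card ≤ M)
    (h : IsPartialSpectrum N B n Λ) :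
    ∃ m Λ', n < m ∧ Λ ⊆ Λ' ∧ IsPartialSpectrum N B m Λ' ∧
      TailBoundedBelow N B (1 / (2 * M)) m Λ' := by
  have hN : ∀ n, 2 ≤ N n := fun n => (hH n).two_le
  have hne : ∀ n, (B n).Nonempty := fun n => (hH n).nonempty
  have hbig : ∀ᶠ m in atTop, n < m ∧ ∀ l ∈ Λ, |(l : ℝ) / scale N m| ≤ 1 / 3 := by
    refine (eventually_gt_atTop n).and ((Finset.eventually_all Λ).2 fun l _ => ?_)
    have h1 : Tendsto (fun m => |(l : ℝ) / scale N m|) atTop (𝓝 0) := by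
      rw [← abs_zero]
      exact ((tendsto_scale_atTop hN).const_div_atTop (l : ℝ)).abs
    exact h1.eventually_le_const (by norm_num)
  obtain ⟨m, hmM, hnm, hsmall⟩ := (hM.and_eventually hbig).exists
  obtain ⟨Λ', hΛ, hΛ'⟩ := h.extend hH hnm.le
  have hM1 : 1 ≤ M := (hne m).card_pos.trans_le hmM
  have hM1' : (1 : ℝ) ≤ M := by exact_mod_cast hM1
  have hchoice : ∀ l : ℤ, ∃ k : ℤ, (|(l : ℝ) / scale N m| ≤ 1 / 3 → k = 0) ∧
      ∀ j, 1 / (2 * M : ℝ) ≤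
        ‖partialTransform (fun i => N (m + i)) (fun i => B (m + i)) j (l / scale N m + k)‖ := by
    intro l
    by_cases hl : |(l : ℝ) / scale N m| ≤ 1 / 3
    · refine ⟨0, fun _ => rfl, fun j => ?_⟩
      rw [Int.cast_zero, add_zero]
      refine le_trans ?_ (half_le_norm_partialTransform (fun i => hN (m + i))
        (fun i => hne (m + i)) (fun i => hB (m + i)) j hl)
      rw [div_le_div_iff₀ (by positivity) (by norm_num)]
      linarith
    · obtain ⟨k, hk⟩ := exists_int_le_norm_partialTransform (fun i => hN (m + i))
        (fun i => hne (m + i)) (fun i => hB (m + i)) ((l : ℝ) / scale N m)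
      refine ⟨k, fun h' => absurd h' hl, fun j => le_trans ?_ (hk j)⟩
      have hc : (0 : ℝ) < (B m).card := by exact_mod_cast (hne m).card_pos
      have hc' : ((B m).card : ℝ) ≤ M := by exact_mod_cast hmM
      rw [add_zero]
      exact one_div_le_one_div_of_le (by positivity) (by linarith)
  choose κ hκ0 hκ using hchoice
  refine ⟨m, _, hnm, fun l hl => ?_, hΛ'.shift hN hne κ, ?_⟩
  · exact Finset.mem_image.2 ⟨l, hΛ hl, by rw [hκ0 l (hsmall l hl)]; simp⟩
  · intro l' hl' j
    obtain ⟨l, hl, rfl⟩ := Finset.mem_image.1 hl'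
    have : ((l + (∏ i ∈ Finset.range m, (N i : ℤ)) * κ l : ℤ) : ℝ) / scale N m =
        l / scale N m + κ l := by
      rw [Int.cast_add, Int.cast_mul, ← scale_eq_intCast, add_div,
        mul_div_cancel_left₀ _ (scale_pos hN m).ne']
    rw [this]
    exact hκ l j

/-- A nested sequence of spectra of finite convolutions on which the tails are bounded below. -/
theorem exists_nested_partialSpectra (hH : ∀ n, IsHadamardTriple (N n) (B n) (L n))
    (hB : ∀ n, B n ⊆ Finset.Ico (0 : ℤ) (N n)) {M : ℕ} (hM : ∃ᶠ n in atTop, (B n).card ≤ M) :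
    ∃ (φ : ℕ → ℕ) (Λ : ℕ → Finset ℤ), StrictMono φ ∧ Monotone Λ ∧
      ∀ k, IsPartialSpectrum N B (φ k) (Λ k) ∧ TailBoundedBelow N B (1 / (2 * M)) (φ k) (Λ k) := by
  let S := {p : ℕ × Finset ℤ //
    IsPartialSpectrum N B p.1 p.2 ∧ TailBoundedBelow N B (1 / (2 * M)) p.1 p.2}
  have hnext : ∀ p : S, ∃ q : S, p.1.1 < q.1.1 ∧ p.1.2 ⊆ q.1.2 := by
    rintro ⟨⟨n, Λ⟩, h, -⟩
    obtain ⟨m, Λ', h1, h2, h3, h4⟩ := h.exists_extension hH hB hM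
    exact ⟨⟨⟨m, Λ'⟩, h3, h4⟩, h1, h2⟩
  choose next hnext1 hnext2 using hnext
  obtain ⟨m, Λ', -, -, h3, h4⟩ := (isPartialSpectrum_zero N B).exists_extension hH hB hM
  let s : ℕ → S := fun k => next^[k] ⟨⟨m, Λ'⟩, h3, h4⟩
  have hs : ∀ k, s (k + 1) = next (s k) := fun k => Function.iterate_succ_apply' _ _ _
  refine ⟨fun k => (s k).1.1, fun k => (s k).1.2, strictMono_nat_of_lt_succ fun k => ?_,
    monotone_nat_of_le_succ fun k => ?_, fun k => (s k).2⟩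
  · rw [hs]
    exact hnext1 _
  · rw [hs]
    exact hnext2 _

end spectra

/-! ### The infinite convolution -/

section limit

variable {N : ℕ → ℕ} {B : ℕ → Finset ℤ}

theorem norm_partialTransform_le_one (N : ℕ → ℕ) (hne : ∀ n, (B n).Nonempty) (n : ℕ) (t : ℝ) :
    ‖partialTransform N B n t‖ ≤ 1 := by
  have := isProbabilityMeasure_partialConvolution N hne n
  rw [partialTransform, expIntegral_eq_charFun]
  exact norm_charFun_le_one _

theorem exists_tendsto_partialTransform (hN : ∀ n, 2 ≤ N n) (hne : ∀ n, (B n).Nonempty)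
    (hB : ∀ n, B n ⊆ Finset.Ico (0 : ℤ) (N n)) (t : ℝ) :
    ∃ z, Tendsto (fun n => partialTransform N B n t) atTop (𝓝 z) := by
  refine cauchySeq_tendsto_of_complete (cauchySeq_of_le_tendsto_0' (fun n =>
    2 * Real.pi * |t / scale N n|) (fun n m hnm => ?_) ?_)
  · obtain ⟨k, rfl⟩ := Nat.exists_eq_add_of_le hnm
    have h := norm_partialTransform_sub_le (fun i => hN (n + i)) (fun i => hne (n + i))
      (fun i => hB (n + i)) k (t / scale N n) 0
    rw [partialTransform_at_zero _ (fun i => hne (n + i)), sub_zero] at h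
    rw [dist_comm, dist_eq_norm, partialTransform_add hN hne]
    calc _ = ‖partialTransform N B n t‖ * ‖partialTransform (fun i => N (n + i))
          (fun i => B (n + i)) k (t / scale N n) - 1‖ := by rw [← norm_mul, mul_sub, mul_one]
      _ ≤ 1 * (2 * Real.pi * |t / scale N n|) :=
          mul_le_mul (norm_partialTransform_le_one N hne n t) h (norm_nonneg _) zero_le_one
      _ = _ := one_mul _
  · have h := (((tendsto_scale_atTop hN).const_div_atTop t).abs).const_mul (2 * Real.pi)
    simpa using h

/-- Weak limits exist: the finite convolutions live on `[0, 1]`, hence are tight, so they have a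
cluster point by Prokhorov's theorem; since their transforms converge pointwise, Lévy's continuity
theorem makes the cluster point a limit. -/
theorem exists_isCantorMoranMeasure (hN : ∀ n, 2 ≤ N n) (hne : ∀ n, (B n).Nonempty)
    (hB : ∀ n, B n ⊆ Finset.Ico (0 : ℤ) (N n)) :
    ∃ μ : ProbabilityMeasure ℝ, IsCantorMoranMeasure N B μ := by
  let u : ℕ → ProbabilityMeasure ℝ := fun n =>
    ⟨partialConvolution N B n, isProbabilityMeasure_partialConvolution N hne n⟩
  have htight : IsTightMeasureSet
      {((ν : ProbabilityMeasure ℝ) : Measure ℝ) | ν ∈ Set.range u} := by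
    rw [isTightMeasureSet_iff_exists_isCompact_measure_compl_le]
    intro ε _
    refine ⟨Set.Icc 0 1, isCompact_Icc, ?_⟩
    rintro _ ⟨_, ⟨n, rfl⟩, rfl⟩
    have h0 : (u n : Measure ℝ) (Set.Icc 0 1)ᶜ = 0 := ae_partialConvolution_mem_unit hN hne hB n
    rw [h0]
    exact zero_le
  have hcomp := isCompact_closure_of_isTightMeasureSet htight
  have hmem : ∀ n, u n ∈ closure (Set.range u) := fun n => subset_closure ⟨n, rfl⟩
  let 𝒰 : Ultrafilter ℕ := Ultrafilter.of atTop
  have h𝒰 : (𝒰 : Filter ℕ) ≤ atTop := Ultrafilter.of_le atTop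
  obtain ⟨μ, -, hμ⟩ := hcomp.ultrafilter_le_nhds (𝒰.map u)
    (tendsto_principal.2 (Eventually.of_forall hmem))
  have hμ' : Tendsto u 𝒰 (𝓝 μ) := hμ
  have hlim : Tendsto u atTop (𝓝 μ) := by
    refine ProbabilityMeasure.tendsto_of_tendsto_charFun fun t => ?_
    obtain ⟨z, hz⟩ := exists_tendsto_partialTransform hN hne hB (t / (2 * Real.pi))
    have hz' : Tendsto (fun n => charFun (u n : Measure ℝ) t) atTop (𝓝 z) := by
      simp only [charFun_eq_expIntegral]
      exact hz
    have h2 : Tendsto (fun n => charFun (u n : Measure ℝ) t) 𝒰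
        (𝓝 (charFun (μ : Measure ℝ) t)) := by
      rw [ProbabilityMeasure.tendsto_iff_forall_integral_rclike_tendsto ℂ] at hμ'
      simp_rw [charFun_eq_integral_innerProbChar]
      exact hμ' (BoundedContinuousFunction.innerProbChar t)
    rwa [tendsto_nhds_unique h2 (hz'.mono_left h𝒰)]
  exact ⟨μ, ProbabilityMeasure.tendsto_iff_forall_integral_tendsto.1 hlim⟩

theorem IsCantorMoranMeasure.unique {μ ν : ProbabilityMeasure ℝ} (hμ : IsCantorMoranMeasure N B μ)
    (hν : IsCantorMoranMeasure N B ν) : μ = ν :=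
  Subtype.ext <| show (μ : Measure ℝ) = ν from
    ext_of_forall_integral_eq_of_IsFiniteMeasure fun f => tendsto_nhds_unique (hμ f) (hν f)

variable {μ : ProbabilityMeasure ℝ}

theorem IsCantorMoranMeasure.tendsto_partialTransform (hne : ∀ n, (B n).Nonempty)
    (hμ : IsCantorMoranMeasure N B μ) (t : ℝ) :
    Tendsto (fun n => partialTransform N B n t) atTop (𝓝 (expIntegral μ t)) := by
  let u : ℕ → ProbabilityMeasure ℝ := fun n =>
    ⟨partialConvolution N B n, isProbabilityMeasure_partialConvolution N hne n⟩
  have hlim : Tendsto u atTop (𝓝 μ) :=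
    ProbabilityMeasure.tendsto_iff_forall_integral_tendsto.2 hμ
  have h := ProbabilityMeasure.tendsto_iff_tendsto_charFun.1 hlim (2 * Real.pi * t)
  simp only [← expIntegral_eq_charFun] at h
  exact h

theorem IsCantorMoranMeasure.norm_expIntegral_le (hN : ∀ n, 2 ≤ N n) (hne : ∀ n, (B n).Nonempty)
    (hμ : IsCantorMoranMeasure N B μ) (n : ℕ) (t : ℝ) :
    ‖expIntegral μ t‖ ≤ ‖partialTransform N B n t‖ := by
  refine le_of_tendsto (hμ.tendsto_partialTransform hne t).norm
    (eventually_atTop.2 ⟨n, fun m hm => ?_⟩)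
  obtain ⟨k, rfl⟩ := Nat.exists_eq_add_of_le hm
  rw [partialTransform_add hN hne, norm_mul]
  exact mul_le_of_le_one_right (norm_nonneg _)
    (norm_partialTransform_le_one _ (fun i => hne (n + i)) _ _)

theorem IsCantorMoranMeasure.le_norm_expIntegral (hN : ∀ n, 2 ≤ N n) (hne : ∀ n, (B n).Nonempty)
    (hB : ∀ n, B n ⊆ Finset.Ico (0 : ℤ) (N n)) (hμ : IsCantorMoranMeasure N B μ) {ε : ℝ} {n : ℕ}
    {Λ : Finset ℤ} (hΛ : TailBoundedBelow N B ε n Λ) {l : ℤ} (hl : l ∈ Λ) (x : ℝ) :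
    (ε - 2 * Real.pi * |x / scale N n|) * ‖partialTransform N B n (x + l)‖ ≤
      ‖expIntegral μ (x + l)‖ := by
  refine ge_of_tendsto (hμ.tendsto_partialTransform hne (x + l)).norm
    (eventually_atTop.2 ⟨n, fun m hm => ?_⟩)
  obtain ⟨k, rfl⟩ := Nat.exists_eq_add_of_le hm
  rw [partialTransform_add hN hne, norm_mul, mul_comm]
  refine mul_le_mul_of_nonneg_left ?_ (norm_nonneg _)
  have h1 := hΛ l hl k
  have h2 := norm_partialTransform_sub_le (fun i => hN (n + i)) (fun i => hne (n + i))
      (fun i => hB (n + i)) k (l / scale N n) ((x + l) / scale N n)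
  have h3 : |(l : ℝ) / scale N n - (x + l) / scale N n| = |x / scale N n| := by
    rw [← abs_neg]
    congr 1
    ring
  rw [h3] at h2
  have h4 := norm_sub_norm_le (partialTransform (fun i => N (n + i)) (fun i => B (n + i)) k
    (l / scale N n)) (partialTransform (fun i => N (n + i)) (fun i => B (n + i)) k
    ((x + l) / scale N n))
  linarith

/-- The Jorgensen–Pedersen identity passes to the limit by dominated convergence: boundedness below
of the tails dominates the transforms of the finite convolutions by that of the limit. -/
theorem IsCantorMoranMeasure.hasSum_indicator (hN : ∀ n, 2 ≤ N n) (hne : ∀ n, (B n).Nonempty)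
    (hB : ∀ n, B n ⊆ Finset.Ico (0 : ℤ) (N n)) (hμ : IsCantorMoranMeasure N B μ) {ε : ℝ}
    (hε : 0 < ε) {φ : ℕ → ℕ} {Λ : ℕ → Finset ℤ} (hφ : StrictMono φ) (hmono : Monotone Λ)
    (hΛ : ∀ k, IsPartialSpectrum N B (φ k) (Λ k)) (hε' : ∀ k, TailBoundedBelow N B ε (φ k) (Λ k))
    (x : ℝ) :
    HasSum ((⋃ k, (Λ k : Set ℤ)).indicator fun l => ‖expIntegral μ (x + l)‖ ^ 2) 1 := by
  set S : Set ℤ := ⋃ k, (Λ k : Set ℤ) with hS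
  set g : ℤ → ℝ := S.indicator fun l => ‖expIntegral μ (x + l)‖ ^ 2 with hg
  set f : ℕ → ℤ → ℝ := fun k => (Λ k : Set ℤ).indicator fun l =>
    ‖partialTransform N B (φ k) (x + l)‖ ^ 2
  have hg0 : ∀ l, 0 ≤ g l := fun l => Set.indicator_nonneg (fun _ _ => by positivity) l
  have hsub : ∀ k, (Λ k : Set ℤ) ⊆ S := fun k => Set.subset_iUnion (fun k => (Λ k : Set ℤ)) k
  have hmem : ∀ l ∈ S, ∀ᶠ k in atTop, l ∈ Λ k := by
    intro l hl
    obtain ⟨k, hk⟩ := Set.mem_iUnion.1 hl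
    exact eventually_atTop.2 ⟨k, fun j hj => hmono hj hk⟩
  have hsum : Summable g := by
    refine summable_of_sum_le hg0 (c := 1) fun T => ?_
    classical
    have hev : ∀ᶠ k in atTop, ∀ l ∈ T.filter (· ∈ S), l ∈ Λ k :=
      (Finset.eventually_all _).2 fun l hl => hmem l (Finset.mem_filter.1 hl).2
    obtain ⟨k, hk⟩ := hev.exists
    have hzero : ∑ l ∈ T.filter (¬ · ∈ S), g l = 0 := Finset.sum_eq_zero fun l hl =>
      Set.indicator_of_notMem (Finset.mem_filter.1 hl).2 _
    rw [← Finset.sum_filter_add_sum_filter_not T (· ∈ S), hzero, add_zero, ← hΛ k x]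
    refine (Finset.sum_le_sum fun l hl => ?_).trans
      (Finset.sum_le_sum_of_subset_of_nonneg (fun l hl => hk l hl) fun _ _ _ => by positivity)
    rw [hg, Set.indicator_of_mem (Finset.mem_filter.1 hl).2]
    exact pow_le_pow_left₀ (norm_nonneg _) (hμ.norm_expIntegral_le hN hne _ _) 2
  have hlim : ∀ l, Tendsto (fun k => f k l) atTop (𝓝 (g l)) := by
    intro l
    by_cases hl : l ∈ S
    · have h1 : Tendsto (fun k => ‖partialTransform N B (φ k) (x + l)‖ ^ 2) atTop (𝓝 (g l)) := by
        rw [hg, Set.indicator_of_mem hl]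
        exact (((hμ.tendsto_partialTransform hne (x + l)).comp hφ.tendsto_atTop).norm).pow 2
      refine h1.congr' ?_
      filter_upwards [hmem l hl] with k hk
      exact (Set.indicator_of_mem (Finset.mem_coe.2 hk)
        fun l : ℤ => ‖partialTransform N B (φ k) (x + l)‖ ^ 2).symm
    · have h1 : ∀ k, f k l = g l := fun k => by
        rw [hg, Set.indicator_of_notMem hl]
        exact Set.indicator_of_notMem (fun h => hl (hsub k h)) _
      simp only [h1]
      exact tendsto_const_nhds
  have hbound : ∀ᶠ k in atTop, ∀ l, ‖f k l‖ ≤ (2 / ε) ^ 2 * g l := by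
    have h1 : Tendsto (fun k => 2 * Real.pi * |x / scale N (φ k)|) atTop (𝓝 0) := by
      have h := ((((tendsto_scale_atTop hN).comp hφ.tendsto_atTop).const_div_atTop x).abs).const_mul
        (2 * Real.pi)
      simpa using h
    filter_upwards [h1.eventually_le_const (half_pos hε)] with k hk l
    by_cases hl : l ∈ Λ k
    · have h2 := hμ.le_norm_expIntegral hN hne hB (hε' k) hl x
      have h3 : ε / 2 * ‖partialTransform N B (φ k) (x + l)‖ ≤ ‖expIntegral μ (x + l)‖ :=
        (mul_le_mul_of_nonneg_right (by linarith) (norm_nonneg _)).trans h2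
      have h4 : ‖partialTransform N B (φ k) (x + l)‖ ≤ 2 / ε * ‖expIntegral μ (x + l)‖ := by
        rw [div_mul_eq_mul_div, le_div_iff₀ hε]
        linarith
      have hfl : f k l = ‖partialTransform N B (φ k) (x + l)‖ ^ 2 :=
        Set.indicator_of_mem (Finset.mem_coe.2 hl) _
      rw [hfl, hg, Set.indicator_of_mem (hsub k hl), ← mul_pow, Real.norm_of_nonneg (by positivity)]
      exact pow_le_pow_left₀ (norm_nonneg _) h4 2
    · have hfl : f k l = 0 := Set.indicator_of_notMem (fun h => hl (Finset.mem_coe.1 h)) _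
      rw [hfl, norm_zero]
      exact mul_nonneg (by positivity) (hg0 l)
  have htends := tendsto_tsum_of_dominated_convergence (hsum.mul_left _) hlim hbound
  have hone : ∀ k, ∑' l, f k l = 1 := fun k => by
    rw [← hΛ k x, sum_eq_tsum_indicator]
  simp only [hone] at htends
  rw [← tendsto_nhds_unique htends tendsto_const_nhds]
  exact hsum.hasSum

end limit

/-! ### Completeness of exponentials -/

theorem ae_eq_zero_of_integral_ofReal_mul_expFun {μ : Measure ℝ} {h : ℝ → ℝ}
    (hh : Integrable h μ) (h0 : ∀ t, ∫ x, (h x : ℂ) * expFun t x ∂μ = 0) : h =ᵐ[μ] 0 := by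
  have hfin : ∀ {k : ℝ → ℝ}, Integrable k μ →
      IsFiniteMeasure (μ.withDensity fun x => ENNReal.ofReal (k x)) := fun hk =>
    isFiniteMeasure_withDensity_ofReal hk.2
  have hint : ∀ {k : ℝ → ℝ}, Integrable k μ → ∀ t,
      expIntegral (μ.withDensity fun x => ENNReal.ofReal (k x)) t =
        ∫ x, ((max (k x) 0 : ℝ) : ℂ) * expFun t x ∂μ := by
    intro k hk t
    rw [expIntegral, integral_withDensity_eq_integral_toReal_smul₀ hk.1.aemeasurable.ennreal_ofReal
      (Eventually.of_forall fun _ => ENNReal.ofReal_lt_top)]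
    simp only [ENNReal.toReal_ofReal', Complex.real_smul]
  have hmul : ∀ {k : ℝ → ℝ}, Integrable k μ → ∀ t,
      Integrable (fun x => (k x : ℂ) * expFun t x) μ := by
    intro k hk t
    refine (hk.ofReal (𝕜 := ℂ)).mul_bdd (c := 1) (continuous_expFun t).aestronglyMeasurable ?_
    exact Eventually.of_forall fun x => (norm_expFun t x).le
  have := hfin hh
  have := hfin hh.neg
  -- The positive and the negative part of `h` define measures with the same transform.
  have heq : μ.withDensity (fun x => ENNReal.ofReal (h x)) =
      μ.withDensity (fun x => ENNReal.ofReal ((-h) x)) := by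
    refine Measure.ext_of_charFun (funext fun t => ?_)
    rw [charFun_eq_expIntegral, charFun_eq_expIntegral, hint hh, hint hh.neg, ← sub_eq_zero,
      ← integral_sub (hmul hh.pos_part _) (hmul hh.neg.pos_part _), ← h0 (t / (2 * Real.pi))]
    refine integral_congr_ae (Eventually.of_forall fun x => ?_)
    simp only [Pi.neg_apply]
    rw [← sub_mul, ← Complex.ofReal_sub]
    congr 2
    rcases le_total (h x) 0 with hx | hx
    · rw [max_eq_right hx, max_eq_left (by linarith)]
      ring
    · rw [max_eq_left hx, max_eq_right (by linarith)]
      ring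
  have hne : ∫⁻ x, ENNReal.ofReal (h x) ∂μ ≠ ⊤ := hh.lintegral_lt_top.ne
  have hae := (withDensity_eq_iff hh.1.aemeasurable.ennreal_ofReal
    hh.neg.1.aemeasurable.ennreal_ofReal hne).1 heq
  filter_upwards [hae] with x hx
  simp only [Pi.neg_apply] at hx
  rcases lt_trichotomy (h x) 0 with hlt | hx0 | hgt
  · rw [ENNReal.ofReal_of_nonpos hlt.le] at hx
    exact absurd hx.symm (ENNReal.ofReal_pos.2 (by linarith)).ne'
  · exact hx0
  · rw [ENNReal.ofReal_of_nonpos (by linarith : -h x ≤ 0)] at hx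
    exact absurd hx (ENNReal.ofReal_pos.2 hgt).ne'

theorem ae_eq_zero_of_integral_mul_expFun {μ : Measure ℝ} {f : ℝ → ℂ}
    (hf : Integrable f μ) (h0 : ∀ t, ∫ x, f x * expFun t x ∂μ = 0) : f =ᵐ[μ] 0 := by
  have hmul : ∀ {k : ℝ → ℂ}, Integrable k μ → ∀ t, Integrable (fun x => k x * expFun t x) μ := by
    intro k hk t
    refine hk.mul_bdd (c := 1) (continuous_expFun t).aestronglyMeasurable ?_
    exact Eventually.of_forall fun x => (norm_expFun t x).le
  have hconj : Integrable (fun x => (starRingEnd ℂ) (f x)) μ := by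
    refine hf.congr' (Complex.continuous_conj.comp_aestronglyMeasurable hf.1) ?_
    exact Eventually.of_forall fun x => (RCLike.norm_conj (f x)).symm
  have h1 : ∀ t, ∫ x, (starRingEnd ℂ) (f x) * expFun t x ∂μ = 0 := by
    intro t
    have h := congrArg (starRingEnd ℂ) (h0 (-t))
    rw [← integral_conj, map_zero] at h
    simpa only [map_mul, conj_expFun, neg_neg] using h
  have hre : (fun x => (f x).re) =ᵐ[μ] 0 := by
    refine ae_eq_zero_of_integral_ofReal_mul_expFun hf.re fun t => ?_
    have h : ∀ x, (((f x).re : ℝ) : ℂ) * expFun t x =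
        (1 / 2 : ℂ) * (f x * expFun t x + (starRingEnd ℂ) (f x) * expFun t x) := by
      intro x
      rw [Complex.re_eq_add_conj]
      ring
    change ∫ x, (((f x).re : ℝ) : ℂ) * expFun t x ∂μ = 0
    simp only [h]
    rw [integral_const_mul, integral_add (hmul hf t) (hmul hconj t), h0, h1]
    simp
  have him : (fun x => (f x).im) =ᵐ[μ] 0 := by
    refine ae_eq_zero_of_integral_ofReal_mul_expFun hf.im fun t => ?_
    have h : ∀ x, (((f x).im : ℝ) : ℂ) * expFun t x =
        (1 / (2 * Complex.I) : ℂ) *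
          (f x * expFun t x - (starRingEnd ℂ) (f x) * expFun t x) := by
      intro x
      rw [Complex.im_eq_sub_conj]
      ring
    change ∫ x, (((f x).im : ℝ) : ℂ) * expFun t x ∂μ = 0
    simp only [h]
    rw [integral_const_mul, integral_sub (hmul hf t) (hmul hconj t), h0, h1]
    simp
  filter_upwards [hre, him] with x hx hy
  exact Complex.ext hx hy

theorem inner_expLp (μ : Measure ℝ) [IsFiniteMeasure μ] (s : ℝ) (g : Lp ℂ 2 μ) :
    inner ℂ (expLp μ s) g = ∫ x, g x * expFun (-s) x ∂μ := by
  rw [L2.inner_def]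
  refine integral_congr_ae ?_
  filter_upwards [(memLp_expFun μ s).coeFn_toLp] with x hx
  rw [expLp, hx, RCLike.inner_apply, conj_expFun]

theorem inner_expLp_expLp (μ : Measure ℝ) [IsFiniteMeasure μ] (s t : ℝ) :
    inner ℂ (expLp μ s) (expLp μ t) = expIntegral μ (-s + t) := by
  rw [inner_expLp, expIntegral]
  refine integral_congr_ae ?_
  filter_upwards [(memLp_expFun μ t).coeFn_toLp] with x hx
  rw [expLp, hx, mul_comm, ← expFun_add_left]

theorem norm_expLp (μ : Measure ℝ) [IsProbabilityMeasure μ] (s : ℝ) : ‖expLp μ s‖ = 1 := by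
  have h : (‖expLp μ s‖ : ℂ) ^ 2 = 1 := by
    have := inner_self_eq_norm_sq_to_K (𝕜 := ℂ) (expLp μ s)
    rw [inner_expLp_expLp, neg_add_cancel, expIntegral_zero] at this
    exact this.symm
  have h' : ‖expLp μ s‖ ^ 2 = 1 := by exact_mod_cast h
  exact (pow_eq_one_iff_of_nonneg (norm_nonneg _) two_ne_zero).1 h'

theorem eq_zero_of_forall_inner_expLp {μ : Measure ℝ} [IsFiniteMeasure μ] {g : Lp ℂ 2 μ}
    (h : ∀ t, inner ℂ (expLp μ t) g = 0) : g = 0 := by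
  refine (Lp.eq_zero_iff_ae_eq_zero).2 (ae_eq_zero_of_integral_mul_expFun
    ((Lp.memLp g).integrable (by norm_num)) fun t => ?_)
  have := h (-t)
  rwa [inner_expLp, neg_neg] at this

/-- If Bessel's inequality for `u` is an equality, then `u` is orthogonal to everything that is
orthogonal to the family. -/
theorem Orthonormal.inner_eq_zero_of_hasSum {E ι : Type*} [NormedAddCommGroup E]
    [InnerProductSpace ℂ E] {v : ι → E} (hv : Orthonormal ℂ v) {u g : E}
    (hu : HasSum (fun i => ‖inner ℂ (v i) u‖ ^ 2) (‖u‖ ^ 2)) (hg : ∀ i, inner ℂ (v i) g = 0) :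
    inner ℂ u g = 0 := by
  have hle : ∀ s : Finset ι,
      ‖inner ℂ u g‖ ^ 2 ≤ (‖u‖ ^ 2 - ∑ i ∈ s, ‖inner ℂ (v i) u‖ ^ 2) * ‖g‖ ^ 2 := by
    intro s
    set p := ∑ i ∈ s, inner ℂ (v i) u • v i with hp
    have hpg : inner ℂ p g = 0 := by
      rw [hp, sum_inner]
      exact Finset.sum_eq_zero fun i _ => by rw [inner_smul_left, hg, mul_zero]
    have hpi : ∀ i ∈ s, inner ℂ (v i) (u - p) = 0 := by
      intro i hi
      rw [inner_sub_right, hp, hv.inner_right_sum _ hi, sub_self]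
    have hpp : inner ℂ p (u - p) = 0 := by
      rw [hp, sum_inner]
      exact Finset.sum_eq_zero fun i hi => by rw [inner_smul_left, ← hp, hpi i hi, mul_zero]
    have hpyth : ‖u‖ ^ 2 = ‖p‖ ^ 2 + ‖u - p‖ ^ 2 := by
      have := norm_add_sq_eq_norm_sq_add_norm_sq_of_inner_eq_zero p (u - p) hpp
      rw [add_sub_cancel] at this
      nlinarith
    have hnp : ‖p‖ ^ 2 = ∑ i ∈ s, ‖inner ℂ (v i) u‖ ^ 2 := by
      have h1 : ((‖p‖ ^ 2 : ℝ) : ℂ) = ((∑ i ∈ s, ‖inner ℂ (v i) u‖ ^ 2 : ℝ) : ℂ) := by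
        have h2 := inner_self_eq_norm_sq_to_K (𝕜 := ℂ) p
        push_cast
        rw [← Complex.coe_algebraMap] at *
        rw [← h2, hp, hv.inner_sum]
        refine Finset.sum_congr rfl fun i _ => ?_
        rw [← RCLike.conj_mul]
      exact Complex.ofReal_injective h1
    have hug : inner ℂ u g = inner ℂ (u - p) g := by rw [inner_sub_left, hpg, sub_zero]
    rw [hug, ← hnp, hpyth, add_sub_cancel_left, ← mul_pow]
    exact pow_le_pow_left₀ (norm_nonneg _) (norm_inner_le_norm _ _) 2
  have hlim : Tendsto (fun s : Finset ι =>
      (‖u‖ ^ 2 - ∑ i ∈ s, ‖inner ℂ (v i) u‖ ^ 2) * ‖g‖ ^ 2) atTop (𝓝 0) := by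
    have h : Tendsto (fun s : Finset ι => ∑ i ∈ s, ‖inner ℂ (v i) u‖ ^ 2) atTop (𝓝 (‖u‖ ^ 2)) := hu
    have h' := (h.const_sub (‖u‖ ^ 2)).mul_const (‖g‖ ^ 2)
    rwa [sub_self, zero_mul] at h'
  have h0 := ge_of_tendsto' hlim hle
  have h1 : ‖inner ℂ u g‖ ^ 2 = 0 := le_antisymm h0 (sq_nonneg _)
  exact norm_eq_zero.1 (pow_eq_zero_iff two_ne_zero |>.1 h1)

/-- The Jorgensen–Pedersen criterion. The identity at `x = -s` gives orthogonality of the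
exponentials; for general `x` it says that Bessel's inequality for `exp(-2πi x ·)` is an
equality. -/
theorem isSpectrum_of_hasSum {μ : Measure ℝ} [IsProbabilityMeasure μ] {S : Set ℝ}
    (hS : S.Countable) (h : ∀ x, HasSum (fun s : S => ‖expIntegral μ (x + s)‖ ^ 2) 1) :
    IsSpectrum μ S := by
  classical
  have hv : Orthonormal ℂ fun s : S => expLp μ s := by
    refine ⟨fun s => norm_expLp μ s, fun s t hst => ?_⟩
    change inner ℂ (expLp μ s) (expLp μ t) = 0
    rw [inner_expLp_expLp]
    have h1 := sum_le_hasSum {s, t} (fun _ _ => by positivity) (h (-s))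
    rw [Finset.sum_pair hst, neg_add_cancel, expIntegral_zero] at h1
    have h2 : ‖expIntegral μ (-s + t)‖ ^ 2 = 0 :=
      le_antisymm (by simpa using h1) (sq_nonneg _)
    exact norm_eq_zero.1 (pow_eq_zero_iff two_ne_zero |>.1 h2)
  have hbot : (Submodule.span ℂ (Set.range fun s : S => expLp μ s))ᗮ = ⊥ := by
    rw [Submodule.eq_bot_iff]
    intro g hg
    refine eq_zero_of_forall_inner_expLp fun t => ?_
    refine hv.inner_eq_zero_of_hasSum ?_ fun s =>
      (Submodule.mem_orthogonal _ _).1 hg _ (Submodule.subset_span ⟨s, rfl⟩)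
    rw [norm_expLp, one_pow]
    have h1 : ∀ s : S, ‖inner ℂ (expLp μ s) (expLp μ t)‖ ^ 2 = ‖expIntegral μ (-t + s)‖ ^ 2 := by
      intro s
      rw [norm_inner_symm, inner_expLp_expLp]
    simp only [h1]
    exact h (-t)
  refine ⟨hS, HilbertBasis.mkOfOrthogonalEqBot hv hbot, fun t => ?_⟩
  rw [HilbertBasis.coe_mkOfOrthogonalEqBot]

/-- The Cantor–Moran measure (the weak limit of the finite convolutions) exists and is unique, it is
spectral, and it has a spectrum consisting of integers. -/
theorem theorem1p2 (N : ℕ → ℕ) (B L : ℕ → Finset ℤ)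
    (hH : ∀ n, IsHadamardTriple (N n) (B n) (L n))
    (hB : ∀ n, B n ⊆ Finset.Ico (0 : ℤ) (N n : ℤ))
    (hliminf : liminf (fun n => ((B n).card : ℕ∞)) atTop < ⊤) :
    (∃! μ : ProbabilityMeasure ℝ, IsCantorMoranMeasure N B μ) ∧
    ∀ μ : ProbabilityMeasure ℝ, IsCantorMoranMeasure N B μ →
      IsSpectralMeasure (μ : Measure ℝ) ∧
      ∃ S : Set ℝ, S ⊆ Set.range ((↑) : ℤ → ℝ) ∧ IsSpectrum (μ : Measure ℝ) S := by
  have hN : ∀ n, 2 ≤ N n := fun n => (hH n).two_le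
  have hne : ∀ n, (B n).Nonempty := fun n => (hH n).nonempty
  obtain ⟨μ₀, hμ₀⟩ := exists_isCantorMoranMeasure hN hne hB
  refine ⟨⟨μ₀, hμ₀, fun ν hν => hν.unique hμ₀⟩, fun μ hμ => ?_⟩
  obtain ⟨M, hM⟩ : ∃ M : ℕ, ∃ᶠ n in atTop, (B n).card ≤ M := by
    obtain ⟨M, hM⟩ := ENat.ne_top_iff_exists.1 hliminf.ne
    refine ⟨M, ?_⟩
    have hlt : liminf (fun n => ((B n).card : ℕ∞)) atTop < ((M + 1 : ℕ) : ℕ∞) := by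
      rw [← hM]
      exact_mod_cast Nat.lt_succ_self M
    refine (frequently_lt_of_liminf_lt (by isBoundedDefault) hlt).mono fun n hn => ?_
    exact Nat.lt_succ_iff.1 (by exact_mod_cast hn)
  have hM0 : 0 < M := by
    obtain ⟨n, hn⟩ := hM.exists
    exact (hne n).card_pos.trans_le hn
  obtain ⟨φ, Λ, hφ, hmono, hΛ⟩ := exists_nested_partialSpectra hH hB hM
  have hspec : IsSpectrum (μ : Measure ℝ) (((↑) : ℤ → ℝ) '' ⋃ k, (Λ k : Set ℤ)) := by
    refine isSpectrum_of_hasSum ((Set.to_countable _).image _) fun x => ?_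
    rw [← (Equiv.Set.image _ (⋃ k, (Λ k : Set ℤ)) Int.cast_injective).hasSum_iff]
    exact (hasSum_subtype_iff_indicator (f := fun l : ℤ => ‖expIntegral μ (x + l)‖ ^ 2)).2
      (hμ.hasSum_indicator hN hne hB (by positivity) hφ hmono (fun k => (hΛ k).1)
        (fun k => (hΛ k).2) x)
  exact ⟨⟨_, hspec⟩, _, Set.image_subset_range _ _, hspec⟩
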